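/- Let $ID$ be the class of infinitely divisible distributions on $\mathbb R^d$. Each $\mu\in ID$ has a unique triplet $(A_\mu,\nu_\mu,\gamma_\mu)$, with $A_\mu$ a symmetric nonnegative-definite matrix, $\nu_\mu$ a measure satisfying $\nu_\mu(\{0\})=0$ and $\int(|x|^2\wedge1)\,\nu_\mu(dx)<\infty$, and $\gamma_\mu\in\mathbb R^d$, such that \[ \widehat\mu(z)=\exp\Bigl[-\tfrac12\langle z,A_\mu z\rangle+\int_{\mathbb R^d}\bigl(e^{i\langle z,x\rangle}-1-i\langle z,x\rangle 1_{\{|x|\le1\}}(x)\bigr)\nu_\mu(dx)+i\langle\gamma_\mu,z\rangle\Bigr],\quad z\in\mathbb R^d. \] Let $ID_0=\{\mu\in ID: A_\mu=0\}$. The inversion of $\mu\in ID_0$ is the distribution $\mu'\in ID_0$ with \[ \nu_{\mu'}(B)=\int_{\mathbb R^d\setminus\{0\}}1_B\bigl(|x|^{-2}x\bigr)|x|^2\,\nu_\mu(dx)\quad\text{for all Borel }B\subset\mathbb R^d,\qquad \gamma_{\mu'}=-\gamma_\mu+\int_{|x|=1}x\,\nu_\mu(dx). \] For $b>0$ let $(T_b\mu)(B)=\int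 1_B(bx)\,\mu(dx)$; for $\mu\in ID$ and $s\ge0$ let $\mu^s$ be the distribution with characteristic function $\widehat\mu(z)^s$ (defined by the continuous logarithm of $\widehat\mu$ vanishing at $0$); and let $\delta_c$ be the unit point mass at $c$. For $0<\alpha\le2$ and $b>1$, $\mu\in ID$ is called $\alpha$-semistable with a span $b$ if $\mu^{b^\alpha}=(T_b\mu)*\delta_c$ for some $c\in\mathbb R^d$, and strictly $\alpha$-semistable with a span $b$ if $\mu^{b^\alpha}=T_b\mu$. It is called $\alpha$-stable [resp. strictly $\alpha$-stable] if for every $b>1$ it is $\alpha$-semistable [resp. strictly $\alpha$-semistable] with a span $b$. **Theorem.** Let $0<\alpha<2$, $b>1$ and $\mu\in ID_0$. (i) $\mu'$ is $(2-\alpha)$-semistable with a span $b$ if and only if $\mu$ is $\alpha$-semistable with a span $b$. (ii) $\mu'$ is strictly $(2-\alpha)$-semistable with a span $b$ if and only if $\mu$ is strictly $\alpha$-semistable with a span $b$. (iii) $\mu'$ is $(2-\alpha)$-stable if and only if $\mu$ is $\alpha$-stable. (iv) $\mu'$ is strictly $(2-\alpha)$-stable if and only if $\mu$ is strictly $\alpha$-stable.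 -/

import Mathlib

open MeasureTheory
open scoped ENNReal MeasureTheory

namespace InversionID

/-- Iterated convolution: the `n`-fold convolution of `ρ` with itself. -/
noncomputable def convIter {d : ℕ} (ρ : Measure (EuclideanSpace ℝ (Fin d))) :
    ℕ → Measure (EuclideanSpace ℝ (Fin d))
  | 0 => Measure.dirac 0
  | n + 1 => convIter ρ n ∗ ρ

/-- The class `ID` of infinitely divisible distributions on `ℝ^d`: probability measures that have
an `n`-th convolution root, itself a probability measure, for every `n ≥ 1`. -/
def IsInfDiv {d : ℕ} (μ : Measure (EuclideanSpace ℝ (Fin d))) : Prop :=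
  IsProbabilityMeasure μ ∧
    ∀ n : ℕ, 1 ≤ n → ∃ ρ : Measure (EuclideanSpace ℝ (Fin d)),
      IsProbabilityMeasure ρ ∧ convIter ρ n = μ

/-- `ν` is a Lévy measure: `ν {0} = 0` and `∫ (|x|² ∧ 1) ν(dx) < ∞`. -/
def IsLevyMeasure {d : ℕ} (ν : Measure (EuclideanSpace ℝ (Fin d))) : Prop :=
  ν {0} = 0 ∧ ∫⁻ x, ENNReal.ofReal (min (‖x‖ ^ 2) 1) ∂ν < ∞

/-- The Lévy–Khintchine exponent
`-½ ⟨z, A z⟩ + ∫ (exp (i⟨z,x⟩) - 1 - i⟨z,x⟩ 1_{|x| ≤ 1}) ν(dx) + i⟨γ,z⟩`.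
For a Lévy measure `ν` the integrand is `ν`-integrable for every `z`. -/
noncomputable def lkExponent {d : ℕ} (A : Matrix (Fin d) (Fin d) ℝ)
    (ν : Measure (EuclideanSpace ℝ (Fin d))) (γ z : EuclideanSpace ℝ (Fin d)) : ℂ :=
  -(1 / 2 : ℂ) * ((inner ℝ z (WithLp.toLp 2 (A.mulVec z.ofLp)) : ℝ) : ℂ)
    + ∫ x, (Complex.exp (((inner ℝ z x : ℝ) : ℂ) * Complex.I) - 1
        - (Metric.closedBall (0 : EuclideanSpace ℝ (Fin d)) 1).indicator
            (fun y => ((inner ℝ z y : ℝ) : ℂ) * Complex.I) x) ∂ν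
    + ((inner ℝ γ z : ℝ) : ℂ) * Complex.I

/-- `(A, ν, γ)` is the Lévy–Khintchine triplet of `μ`: Gaussian covariance matrix, Lévy measure
and location parameter. -/
def HasTriplet {d : ℕ} (μ : Measure (EuclideanSpace ℝ (Fin d))) (A : Matrix (Fin d) (Fin d) ℝ)
    (ν : Measure (EuclideanSpace ℝ (Fin d))) (γ : EuclideanSpace ℝ (Fin d)) : Prop :=
  IsInfDiv μ ∧ A.PosSemidef ∧ IsLevyMeasure ν ∧
    ∀ z, charFun μ z = Complex.exp (lkExponent A ν γ z)

/-- The class `ID₀` of infinitely divisible distributions without Gaussian part. -/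
def IsID0 {d : ℕ} (μ : Measure (EuclideanSpace ℝ (Fin d))) : Prop :=
  ∃ (ν : Measure (EuclideanSpace ℝ (Fin d))) (γ : EuclideanSpace ℝ (Fin d)), HasTriplet μ 0 ν γ

/-- The geometric inversion `ι(x) = |x|⁻² x` (used for `x ≠ 0` only). -/
noncomputable def geomInv {d : ℕ} (x : EuclideanSpace ℝ (Fin d)) : EuclideanSpace ℝ (Fin d) :=
  (‖x‖ ^ 2)⁻¹ • x

/-- `μ'` is an inversion of `μ`: both lie in `ID₀`, with triplets `(0, ν, γ)` and `(0, ν', γ')`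
such that `ν'(B) = ∫_{x ≠ 0} 1_B(ι(x)) |x|² ν(dx)` for all Borel sets `B`, and
`γ' = -γ + ∫_{|x| = 1} x ν(dx)`. -/
def IsInversion {d : ℕ} (μ μ' : Measure (EuclideanSpace ℝ (Fin d))) : Prop :=
  ∃ (ν ν' : Measure (EuclideanSpace ℝ (Fin d))) (γ γ' : EuclideanSpace ℝ (Fin d)),
    HasTriplet μ 0 ν γ ∧ HasTriplet μ' 0 ν' γ' ∧
    (∀ B, MeasurableSet B →
      ν' B = ∫⁻ x in {0}ᶜ, B.indicator 1 (geomInv x) * ENNReal.ofReal (‖x‖ ^ 2) ∂ν) ∧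
    γ' = -γ + ∫ x in Metric.sphere 0 1, x ∂ν

/-- The inversion of `μ`: the measure `μ'` with `IsInversion μ μ'`. -/
noncomputable def inversion {d : ℕ} (μ : Measure (EuclideanSpace ℝ (Fin d))) :
    Measure (EuclideanSpace ℝ (Fin d)) :=
  Classical.epsilon (IsInversion μ)

/-- The dilation `(T_b μ)(B) = ∫ 1_B(b x) μ(dx)`. -/
noncomputable def dilation {d : ℕ} (b : ℝ) (μ : Measure (EuclideanSpace ℝ (Fin d))) :
    Measure (EuclideanSpace ℝ (Fin d)) :=
  μ.map (fun x => b • x)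

/-- `ρ = μ^s`: the probability measure `ρ` has characteristic function `z ↦ (μ̂ z)^s`, where the
power is `exp (s ψ(z))` for the distinguished logarithm `ψ` of `μ̂`, that is, the unique continuous
function with `ψ(0) = 0` and `μ̂ = exp ψ`. -/
def IsConvPower {d : ℕ} (μ : Measure (EuclideanSpace ℝ (Fin d))) (s : ℝ)
    (ρ : Measure (EuclideanSpace ℝ (Fin d))) : Prop :=
  IsProbabilityMeasure ρ ∧
    ∃ ψ : EuclideanSpace ℝ (Fin d) → ℂ, Continuous ψ ∧ ψ 0 = 0 ∧
      (∀ z, charFun μ z = Complex.exp (ψ z)) ∧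
      ∀ z, charFun ρ z = Complex.exp ((s : ℂ) * ψ z)

/-- `μ` is `α`-semistable with a span `b`: `μ ∈ ID` and `μ^(b^α) = T_b μ ∗ δ_c` for some `c`. -/
def IsSemistable {d : ℕ} (α b : ℝ) (μ : Measure (EuclideanSpace ℝ (Fin d))) : Prop :=
  IsInfDiv μ ∧ ∃ c : EuclideanSpace ℝ (Fin d),
    IsConvPower μ (b ^ α) (dilation b μ ∗ Measure.dirac c)

/-- `μ` is strictly `α`-semistable with a span `b`: `μ ∈ ID` and `μ^(b^α) = T_b μ`. -/
def IsStrictlySemistable {d : ℕ} (α b : ℝ) (μ : Measure (EuclideanSpace ℝ (Fin d))) : Prop :=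
  IsInfDiv μ ∧ IsConvPower μ (b ^ α) (dilation b μ)

/-- `μ` is `α`-stable: `α`-semistable with every span `b > 1`. -/
def IsStable {d : ℕ} (α : ℝ) (μ : Measure (EuclideanSpace ℝ (Fin d))) : Prop :=
  ∀ b : ℝ, 1 < b → IsSemistable α b μ

/-- `μ` is strictly `α`-stable: strictly `α`-semistable with every span `b > 1`. -/
def IsStrictlyStable {d : ℕ} (α : ℝ) (μ : Measure (EuclideanSpace ℝ (Fin d))) : Prop :=
  ∀ b : ℝ, 1 < b → IsStrictlySemistable α b μ

end InversionID

namespace InversionID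

/-! Both sides of each equivalence reduce to equations between triplets. For `μ` with triplet `(0,
ν, γ)`, comparison of continuous logarithms and uniqueness of the triplet show that α-semistability
with span `b` means `T_b ν = b^α ν`. Strictness adds `b (γ - I) = b^α γ`, where `I` is the integral
of `x` over `b⁻¹ < |x| ≤ 1`. This term appears because the truncation at `|x| ≤ 1` does not commute
with dilation (`isConvPower_iff`).

Write `ι(x) = |x|⁻² x`. Since `ι(bx) = b⁻¹ ι(x)` and the weight `|x|²` scales by `b²`, inversion
turns the factor `b^α` into `b^(2-α)` (`dilation_levyInversion`). For the drift, `|x|² ι(x) = x`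
makes first moments of the inverted measure first moments of `ν` over inverted sets. The scaling of
`ν` then relates the annuli on the two sides of the unit sphere, and the sphere term in `γ'`
accounts for the boundary (`drift_levyInversion`).

Inversion is an involution and `2 - (2 - α) = α`, so one implication suffices; stability follows
span by span. The inversion is a choice, so its existence must be proved: compound Poisson laws
approximate a law with any prescribed `ν` and `γ`. -/

open Filter Topology

/-! ### The Lévy–Khintchine integrand and continuity of the exponent. -/

/-- The integrand of the Lévy–Khintchine exponent. -/
noncomputable def levyKernel {d : ℕ} (z x : EuclideanSpace ℝ (Fin d)) : ℂ :=
  Complex.exp (((inner ℝ z x : ℝ) : ℂ) * Complex.I) - 1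
    - (Metric.closedBall (0 : EuclideanSpace ℝ (Fin d)) 1).indicator
        (fun y => ((inner ℝ z y : ℝ) : ℂ) * Complex.I) x

lemma lkExponent_zero {d : ℕ} (ν : Measure (EuclideanSpace ℝ (Fin d)))
    (γ z : EuclideanSpace ℝ (Fin d)) :
    lkExponent 0 ν γ z = ∫ x, levyKernel z x ∂ν + ((inner ℝ γ z : ℝ) : ℂ) * Complex.I := by
  simp [lkExponent, levyKernel]

lemma norm_exp_ofReal_mul_I_sub_one_sub_le (t : ℝ) :
    ‖Complex.exp ((t : ℂ) * Complex.I) - 1 - (t : ℂ) * Complex.I‖ ≤ 3 * t ^ 2 := by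
  have hn : ‖(t : ℂ) * Complex.I‖ = |t| := by simp
  rcases le_total |t| 1 with h | h
  · have := Complex.norm_exp_sub_one_sub_id_le (x := (t : ℂ) * Complex.I) (by rw [hn]; exact h)
    rw [hn, sq_abs] at this
    nlinarith [sq_nonneg t]
  · have h1 : ‖Complex.exp ((t : ℂ) * Complex.I) - 1 - (t : ℂ) * Complex.I‖ ≤ 1 + 1 + |t| := by
      refine (norm_sub_le _ _).trans (add_le_add ((norm_sub_le _ _).trans ?_) hn.le)
      simp [Complex.norm_exp_ofReal_mul_I]
    nlinarith [sq_abs t, abs_nonneg t]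

/-- The compensator leaves a quadratic remainder on the unit ball, and outside it the kernel is
bounded by 2. The bound is locally uniform in `z`, so it serves for dominated convergence as well as
integrability. -/
lemma norm_levyKernel_le {d : ℕ} (z x : EuclideanSpace ℝ (Fin d)) :
    ‖levyKernel z x‖ ≤ (3 * ‖z‖ ^ 2 + 2) * min (‖x‖ ^ 2) 1 := by
  unfold levyKernel
  by_cases hx : ‖x‖ ≤ 1
  · rw [Set.indicator_of_mem (by simpa using hx),
      min_eq_left (pow_le_one₀ (norm_nonneg _) hx)]
    refine (norm_exp_ofReal_mul_I_sub_one_sub_le _).trans ?_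
    have h := abs_real_inner_le_norm z x
    have h2 : (inner ℝ z x) ^ 2 ≤ (‖z‖ * ‖x‖) ^ 2 := by
      rw [← sq_abs]; gcongr
    nlinarith [sq_nonneg ‖x‖]
  · rw [Set.indicator_of_notMem (by simpa using hx), sub_zero,
      min_eq_right (one_le_pow₀ (not_le.1 hx).le)]
    refine (norm_sub_le _ _).trans ?_
    simp only [Complex.norm_exp_ofReal_mul_I, norm_one]
    nlinarith [sq_nonneg ‖z‖]

lemma measurable_levyKernel {d : ℕ} (z : EuclideanSpace ℝ (Fin d)) :
    Measurable (levyKernel z) := by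
  unfold levyKernel
  refine Measurable.sub (by fun_prop) (Measurable.indicator (by fun_prop) ?_)
  exact Metric.isClosed_closedBall.measurableSet

lemma continuous_levyKernel_left {d : ℕ} (x : EuclideanSpace ℝ (Fin d)) :
    Continuous fun z => levyKernel z x := by
  unfold levyKernel
  by_cases hx : x ∈ Metric.closedBall (0 : EuclideanSpace ℝ (Fin d)) 1
  · simp only [Set.indicator_of_mem hx]; fun_prop
  · simp only [Set.indicator_of_notMem hx]; fun_prop

lemma levyKernel_zero_left {d : ℕ} (x : EuclideanSpace ℝ (Fin d)) : levyKernel 0 x = 0 := by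
  simp [levyKernel]

lemma IsLevyMeasure.integrable_min {d : ℕ} {ν : Measure (EuclideanSpace ℝ (Fin d))}
    (hν : IsLevyMeasure ν) : Integrable (fun x => min (‖x‖ ^ 2) 1) ν := by
  refine ⟨by fun_prop, ?_⟩
  rw [hasFiniteIntegral_iff_ofReal (ae_of_all _ fun x => by positivity)]
  exact hν.2

lemma IsLevyMeasure.integrable_levyKernel {d : ℕ} {ν : Measure (EuclideanSpace ℝ (Fin d))}
    (hν : IsLevyMeasure ν) (z : EuclideanSpace ℝ (Fin d)) : Integrable (levyKernel z) ν :=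
  (hν.integrable_min.const_mul (3 * ‖z‖ ^ 2 + 2)).mono'
    (measurable_levyKernel z).aestronglyMeasurable (ae_of_all _ (norm_levyKernel_le z))

lemma IsLevyMeasure.continuous_lkExponent {d : ℕ} {ν : Measure (EuclideanSpace ℝ (Fin d))}
    (hν : IsLevyMeasure ν) (γ : EuclideanSpace ℝ (Fin d)) : Continuous (lkExponent 0 ν γ) := by
  rw [funext (lkExponent_zero ν γ)]
  refine Continuous.add ?_ (by fun_prop)
  refine continuous_iff_continuousAt.2 fun z => ?_
  refine continuousAt_of_dominated
    (bound := fun x => (3 * (‖z‖ + 1) ^ 2 + 2) * min (‖x‖ ^ 2) 1)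
    (Eventually.of_forall fun w => (measurable_levyKernel w).aestronglyMeasurable) ?_
    (hν.integrable_min.const_mul _)
    (ae_of_all _ fun x => (continuous_levyKernel_left x).continuousAt)
  have : ∀ᶠ w in 𝓝 z, ‖w‖ < ‖z‖ + 1 := continuous_norm.continuousAt.eventually_lt_const (by simp)
  filter_upwards [this] with w hw
  refine ae_of_all _ fun x => (norm_levyKernel_le w x).trans ?_
  gcongr

lemma lkExponent_zero_apply_zero {d : ℕ} (ν : Measure (EuclideanSpace ℝ (Fin d)))
    (γ : EuclideanSpace ℝ (Fin d)) : lkExponent 0 ν γ 0 = 0 := by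
  simp [lkExponent_zero, levyKernel_zero_left]

/-- Two continuous logarithms of the same function that agree at one point are equal. -/
lemma eq_of_exp_eq {X : Type*} [TopologicalSpace X] [PreconnectedSpace X] {f g : X → ℂ}
    (hf : Continuous f) (hg : Continuous g) (h : ∀ x, Complex.exp (f x) = Complex.exp (g x))
    {a : X} (ha : f a = g a) : f = g :=
  Complex.isCoveringMap_exp.eq_of_comp_eq hf hg
    (funext fun x => Subtype.ext (h x)) a ha

/-! ### Existence of a law with prescribed Lévy measure and drift. -/

/-- A pointwise limit of characteristic functions that is continuous at `0` is a characteristic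
function. -/
lemma exists_charFun_eq_of_tendsto {E : Type*} [NormedAddCommGroup E] [InnerProductSpace ℝ E]
    [FiniteDimensional ℝ E] [MeasurableSpace E] [BorelSpace E]
    {μ : ℕ → ProbabilityMeasure E} {f : E → ℂ} (hf : ContinuousAt f 0)
    (h : ∀ t, Tendsto (fun n => charFun (μ n : Measure E) t) atTop (𝓝 (f t))) :
    ∃ ρ : Measure E, IsProbabilityMeasure ρ ∧ ∀ t, charFun ρ t = f t := by
  have ht : IsTightMeasureSet (Set.range fun n => (μ n : Measure E)) :=
    isTightMeasureSet_of_tendsto_charFun hf h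
  have hc : IsCompact (closure (Set.range μ)) := by
    refine isCompact_closure_of_isTightMeasureSet ?_
    convert ht using 1
    ext; simp
  obtain ⟨ρ, -, φ, hφ, hlim⟩ := hc.tendsto_subseq (x := μ)
    (fun n => subset_closure ⟨n, rfl⟩)
  refine ⟨ρ, inferInstance, fun t => ?_⟩
  have := (ProbabilityMeasure.tendsto_iff_tendsto_charFun.1 hlim) t
  exact tendsto_nhds_unique this ((h t).comp hφ.tendsto_atTop)

instance isProbabilityMeasure_convIter {d : ℕ} (ρ : Measure (EuclideanSpace ℝ (Fin d)))
    [IsProbabilityMeasure ρ] (n : ℕ) : IsProbabilityMeasure (convIter ρ n) := by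
  induction n with
  | zero => unfold convIter; infer_instance
  | succ n ih => unfold convIter; infer_instance

lemma charFun_convIter {d : ℕ} (ρ : Measure (EuclideanSpace ℝ (Fin d)))
    [IsProbabilityMeasure ρ] (n : ℕ) (t : EuclideanSpace ℝ (Fin d)) :
    charFun (convIter ρ n) t = charFun ρ t ^ n := by
  induction n with
  | zero => simp [convIter]
  | succ n ih => rw [convIter, charFun_conv, ih, pow_succ]

/-- The compound Poisson distribution with finite jump measure `ν`. -/
lemma exists_compoundPoisson {d : ℕ} (ν : Measure (EuclideanSpace ℝ (Fin d)))
    [IsFiniteMeasure ν] : ∃ ρ : Measure (EuclideanSpace ℝ (Fin d)), IsProbabilityMeasure ρ ∧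
      ∀ z, charFun ρ z =
        Complex.exp (∫ x, (Complex.exp (((inner ℝ z x : ℝ) : ℂ) * Complex.I) - 1) ∂ν) := by
  have hint : ∀ z, ∫ x, (Complex.exp (((inner ℝ z x : ℝ) : ℂ) * Complex.I) - 1) ∂ν
      = charFun ν z - (ν.real Set.univ : ℂ) := by
    intro z
    rw [integral_sub, charFun_apply]
    · simp [real_inner_comm]
    · exact (integrable_const (1 : ℝ)).mono' (by fun_prop)
        (ae_of_all _ fun x => by simp [Complex.norm_exp_ofReal_mul_I])
    · exact integrable_const _
  simp_rw [hint]
  -- With `k = n + N + 1`, `m n` moves mass `ν/k` away from the origin; `k` exceeds the total mass,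
  -- so the atom at 0 has nonnegative weight. The `k`-fold convolution has characteristic function
  -- `(1 + c/k)^k`, which tends to `exp c`.
  obtain ⟨N, hN⟩ := exists_nat_ge (ν.real Set.univ)
  let m : ℕ → Measure (EuclideanSpace ℝ (Fin d)) := fun n =>
    ENNReal.ofReal (1 - ν.real Set.univ / (n + N + 1 : ℕ)) • Measure.dirac 0 +
      ENNReal.ofReal (1 / (n + N + 1 : ℕ)) • ν
  have hpos : ∀ n : ℕ, 0 ≤ 1 - ν.real Set.univ / (n + N + 1 : ℕ) := fun n => by
    rw [sub_nonneg, div_le_one (by positivity)]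
    push_cast
    linarith [(Nat.cast_nonneg n : (0 : ℝ) ≤ n)]
  have hm : ∀ n, IsProbabilityMeasure (m n) := fun n => by
    constructor
    have : ν Set.univ = ENNReal.ofReal (ν.real Set.univ) := by simp
    simp only [m, Measure.add_apply, Measure.smul_apply, smul_eq_mul, measure_univ, mul_one]
    rw [this, ← ENNReal.ofReal_mul (by positivity), ← ENNReal.ofReal_add (hpos n) (by positivity)]
    simp [field]
  have hcf : ∀ n z, charFun (m n) z
      = 1 + (charFun ν z - (ν.real Set.univ : ℂ)) / (n + N + 1 : ℕ) := fun n z => by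
    have hb : ∀ (ρ : Measure (EuclideanSpace ℝ (Fin d))) [IsFiniteMeasure ρ], Integrable
        (fun x => Complex.exp (((inner ℝ x z : ℝ) : ℂ) * Complex.I)) ρ := fun ρ _ =>
      (integrable_const (1 : ℝ)).mono' (by fun_prop)
        (ae_of_all _ fun x => by simp [Complex.norm_exp_ofReal_mul_I])
    rw [charFun_apply, integral_add_measure ((hb _).smul_measure ENNReal.ofReal_ne_top)
      ((hb _).smul_measure ENNReal.ofReal_ne_top), integral_smul_measure, integral_smul_measure,
      ← charFun_apply, ← charFun_apply, ENNReal.toReal_ofReal (hpos n),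
      ENNReal.toReal_ofReal (by positivity)]
    simp
    ring
  refine exists_charFun_eq_of_tendsto
    (μ := fun n => ⟨convIter (m n) (n + N + 1), by have := hm n; infer_instance⟩) ?_ fun t => ?_
  · fun_prop
  · have := (Complex.tendsto_one_add_div_pow_exp
      (charFun ν t - (ν.real Set.univ : ℂ))).comp (tendsto_add_atTop_nat (N + 1))
    refine this.congr fun n => ?_
    have := hm n
    simp only [ProbabilityMeasure.coe_mk, charFun_convIter, hcf, Function.comp]
    rfl

lemma IsLevyMeasure.measure_lt_norm_lt_top {d : ℕ} {ν : Measure (EuclideanSpace ℝ (Fin d))}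
    (hν : IsLevyMeasure ν) {r : ℝ} (hr : 0 < r) : ν {x | r < ‖x‖} < ∞ := by
  refine lt_of_le_of_lt (measure_mono ?_)
    (hν.integrable_min.measure_ge_lt_top (ε := min (r ^ 2) 1) (by positivity))
  intro x hx
  simp only [Set.mem_ofPred_eq] at hx ⊢
  gcongr

lemma IsLevyMeasure.restrict_compl_zero {d : ℕ} {ν : Measure (EuclideanSpace ℝ (Fin d))}
    (hν : IsLevyMeasure ν) : ν.restrict {0}ᶜ = ν := by
  refine Measure.restrict_eq_self_of_ae_mem ?_
  rw [ae_iff]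
  simpa using hν.1

lemma IsLevyMeasure.smul {d : ℕ} {ν : Measure (EuclideanSpace ℝ (Fin d))}
    (hν : IsLevyMeasure ν) {s : ℝ≥0∞} (hs : s ≠ ∞) : IsLevyMeasure (s • ν) := by
  refine ⟨by simp [hν.1], ?_⟩
  rw [lintegral_smul_measure]
  exact ENNReal.mul_lt_top hs.lt_top hν.2

lemma lkExponent_smul {d : ℕ} (ν : Measure (EuclideanSpace ℝ (Fin d)))
    {s : ℝ} (hs : 0 ≤ s) (γ z : EuclideanSpace ℝ (Fin d)) :
    lkExponent 0 (ENNReal.ofReal s • ν) (s • γ) z = s * lkExponent 0 ν γ z := by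
  simp only [lkExponent_zero, integral_smul_measure, ENNReal.toReal_ofReal hs,
    real_inner_smul_left, Complex.real_smul]
  push_cast
  ring

/-- The identity is integrable for a Lévy measure on sets that are bounded and bounded away from
the origin. -/
lemma IsLevyMeasure.integrableOn_id {d : ℕ} {ν : Measure (EuclideanSpace ℝ (Fin d))}
    (hν : IsLevyMeasure ν) {r R : ℝ} (hr : 0 < r) {s : Set (EuclideanSpace ℝ (Fin d))}
    (h : ∀ x ∈ s, r < ‖x‖ ∧ ‖x‖ ≤ R) (hs : MeasurableSet s) : IntegrableOn (fun x => x) s ν := by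
  have hfin : ν s < ∞ :=
    (measure_mono fun x hx => (h x hx).1).trans_lt (hν.measure_lt_norm_lt_top hr)
  refine Measure.integrableOn_of_bounded (M := R) hfin.ne (by fun_prop) ?_
  filter_upwards [ae_restrict_mem hs] with x hx using (h x hx).2

/-- The compound Poisson approximation of a law with given Lévy measure. -/
lemma IsLevyMeasure.exists_charFun_truncated {d : ℕ} {ν : Measure (EuclideanSpace ℝ (Fin d))}
    (hν : IsLevyMeasure ν) (γ : EuclideanSpace ℝ (Fin d)) {r : ℝ} (hr : 0 < r) :
    ∃ ρ : Measure (EuclideanSpace ℝ (Fin d)), IsProbabilityMeasure ρ ∧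
      ∀ z, charFun ρ z = Complex.exp
        (∫ x in {x | r < ‖x‖}, levyKernel z x ∂ν + ((inner ℝ γ z : ℝ) : ℂ) * Complex.I) := by
  set s : Set (EuclideanSpace ℝ (Fin d)) := {x | r < ‖x‖}
  have hs : MeasurableSet s := measurableSet_lt (by fun_prop) (by fun_prop)
  set t : Set (EuclideanSpace ℝ (Fin d)) := Metric.closedBall 0 1
  have ht : MeasurableSet t := Metric.isClosed_closedBall.measurableSet
  have : IsFiniteMeasure (ν.restrict s) := ⟨by simpa using hν.measure_lt_norm_lt_top hr⟩
  obtain ⟨ρ, hρ, hcf⟩ := exists_compoundPoisson (ν.restrict s)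
  have hid : IntegrableOn (fun x => x) t (ν.restrict s) := by
    rw [IntegrableOn, Measure.restrict_restrict ht]
    exact hν.integrableOn_id (R := 1) hr (fun x hx => ⟨hx.2, by simpa [t] using hx.1⟩) (ht.inter hs)
  -- The shift supplies the drift and the compensator, whose integral is finite once small jumps are
  -- cut off.
  refine ⟨ρ ∗ Measure.dirac (γ - ∫ x in t, x ∂(ν.restrict s)), inferInstance, fun z => ?_⟩
  rw [charFun_conv, hcf, charFun_dirac, ← Complex.exp_add]
  congr 1
  have h1 : ∫ x, levyKernel z x ∂(ν.restrict s)
      = ∫ x, (Complex.exp (((inner ℝ z x : ℝ) : ℂ) * Complex.I) - 1) ∂(ν.restrict s)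
        - ∫ x in t, ((inner ℝ z x : ℝ) : ℂ) * Complex.I ∂(ν.restrict s) := by
    unfold levyKernel
    rw [integral_sub, integral_indicator ht]
    · refine (integrable_const (2 : ℝ)).mono' (by fun_prop) (ae_of_all _ fun x => ?_)
      refine (norm_sub_le _ _).trans ?_
      simp only [Complex.norm_exp_ofReal_mul_I, norm_one]
      norm_num
    · rw [integrable_indicator_iff ht]
      exact ((hid.const_inner z).ofReal (𝕜 := ℂ)).mul_const _
  have h2 : ∫ x in t, ((inner ℝ z x : ℝ) : ℂ) * Complex.I ∂(ν.restrict s)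
      = ((inner ℝ (∫ x in t, x ∂(ν.restrict s)) z : ℝ) : ℂ) * Complex.I := by
    rw [integral_mul_const, integral_complex_ofReal, integral_inner hid, real_inner_comm]
  rw [h1, h2, inner_sub_left]
  push_cast
  ring

lemma IsLevyMeasure.exists_charFun_eq {d : ℕ} {ν : Measure (EuclideanSpace ℝ (Fin d))}
    (hν : IsLevyMeasure ν) (γ : EuclideanSpace ℝ (Fin d)) :
    ∃ ρ : Measure (EuclideanSpace ℝ (Fin d)), IsProbabilityMeasure ρ ∧
      ∀ z, charFun ρ z = Complex.exp (lkExponent 0 ν γ z) := by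
  have hr : ∀ n : ℕ, (0 : ℝ) < 1 / (n + 1 : ℝ) := fun n => by positivity
  choose ρ hρ hcf using fun n : ℕ => hν.exists_charFun_truncated γ (hr n)
  refine exists_charFun_eq_of_tendsto (μ := fun n => ⟨ρ n, hρ n⟩)
    (Complex.continuous_exp.comp (hν.continuous_lkExponent γ)).continuousAt fun z => ?_
  simp only [ProbabilityMeasure.coe_mk, hcf, lkExponent_zero]
  refine (Complex.continuous_exp.tendsto _).comp (Tendsto.add_const _ ?_)
  have hU : ⋃ n : ℕ, {x : EuclideanSpace ℝ (Fin d) | 1 / (n + 1 : ℝ) < ‖x‖} = {0}ᶜ := by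
    ext x
    simp only [Set.mem_iUnion, Set.mem_ofPred_eq, Set.mem_compl_iff, Set.mem_singleton_iff]
    refine ⟨?_, fun h => exists_nat_one_div_lt (norm_pos_iff.2 h)⟩
    rintro ⟨n, hn⟩ rfl
    exact absurd ((hr n).trans hn) (by simp)
  have := tendsto_setIntegral_of_monotone (μ := ν) (f := levyKernel z)
    (s := fun n : ℕ => {x : EuclideanSpace ℝ (Fin d) | 1 / (n + 1 : ℝ) < ‖x‖})
    (fun n => measurableSet_lt (by fun_prop) (by fun_prop))
    (fun m n hmn => Set.ofPred_subset_ofPred.2 fun x hx =>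
      lt_of_le_of_lt (Nat.one_div_le_one_div hmn) hx)
    (hν.integrable_levyKernel z).integrableOn
  rwa [hU, hν.restrict_compl_zero] at this

/-- The existence part of the Lévy–Khintchine theorem, without Gaussian part. -/
lemma IsLevyMeasure.exists_hasTriplet {d : ℕ} {ν : Measure (EuclideanSpace ℝ (Fin d))}
    (hν : IsLevyMeasure ν) (γ : EuclideanSpace ℝ (Fin d)) :
    ∃ μ : Measure (EuclideanSpace ℝ (Fin d)), HasTriplet μ 0 ν γ := by
  obtain ⟨μ, hμ, hcf⟩ := hν.exists_charFun_eq γ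
  refine ⟨μ, ⟨hμ, fun n hn => ?_⟩, Matrix.PosSemidef.zero, hν, hcf⟩
  -- The `n`-th root is the law with Lévy measure `ν/n` and drift `γ/n`.
  obtain ⟨ρ, hρ, hρcf⟩ :=
    (hν.smul (s := ENNReal.ofReal (n : ℝ)⁻¹) ENNReal.ofReal_ne_top).exists_charFun_eq
      ((n : ℝ)⁻¹ • γ)
  refine ⟨ρ, hρ, Measure.ext_of_charFun (funext fun z => ?_)⟩
  have hn' : (n : ℂ) ≠ 0 := by exact_mod_cast (by omega : n ≠ 0)
  rw [charFun_convIter, hρcf, hcf, lkExponent_smul ν (by positivity), ← Complex.exp_nat_mul]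
  push_cast
  rw [mul_inv_cancel_left₀ hn']

/-! ### Uniqueness of the triplet. -/

/-- A symmetric second difference in `z` cancels the linear compensator and leaves a Fourier kernel
with the nonnegative weight `1 - cos⟨w, x⟩`. -/
lemma levyKernel_second_difference {d : ℕ} (z w x : EuclideanSpace ℝ (Fin d)) :
    levyKernel (z + w) x + levyKernel (z - w) x - 2 * levyKernel z x
      = -2 * ((1 - Real.cos (inner ℝ w x) : ℝ)
        * Complex.exp (((inner ℝ x z : ℝ) : ℂ) * Complex.I)) := by
  have hc := Complex.two_cos ((inner ℝ w x : ℝ) : ℂ)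
  unfold levyKernel
  by_cases hx : x ∈ Metric.closedBall (0 : EuclideanSpace ℝ (Fin d)) 1
  all_goals
    simp only [hx, Set.indicator_of_mem, Set.indicator_of_notMem, not_false_eq_true,
      inner_add_left, inner_sub_left]
    push_cast
    rw [real_inner_comm z x, add_mul, sub_mul, sub_eq_add_neg (_ * Complex.I) (_ * Complex.I),
      Complex.exp_add, Complex.exp_add, ← neg_mul]
    linear_combination -Complex.exp (((inner ℝ z x : ℝ) : ℂ) * Complex.I) * hc

lemma IsLevyMeasure.integrable_one_sub_cos {d : ℕ} {ν : Measure (EuclideanSpace ℝ (Fin d))}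
    (hν : IsLevyMeasure ν) (w : EuclideanSpace ℝ (Fin d)) :
    Integrable (fun x => 1 - Real.cos (inner ℝ w x)) ν := by
  have := (((hν.integrable_levyKernel (0 + w)).add (hν.integrable_levyKernel (0 - w))).sub
    ((hν.integrable_levyKernel 0).const_mul 2)).re.const_mul (-1 / 2)
  refine this.congr (ae_of_all _ fun x => ?_)
  simp only [Pi.add_apply, Pi.sub_apply]
  rw [levyKernel_second_difference]
  simp [-Complex.ofReal_cos]
  ring

/-- The exponent thus determines the finite measures `(1 - cos⟨w, x⟩) ν(dx)`, to which uniqueness of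
characteristic functions applies. -/
lemma IsLevyMeasure.charFun_withDensity {d : ℕ} {ν : Measure (EuclideanSpace ℝ (Fin d))}
    (hν : IsLevyMeasure ν) (γ w z : EuclideanSpace ℝ (Fin d)) :
    charFun (ν.withDensity fun x => ENNReal.ofReal (1 - Real.cos (inner ℝ w x))) z
      = -(1 / 2) * (lkExponent 0 ν γ (z + w) + lkExponent 0 ν γ (z - w)
        - 2 * lkExponent 0 ν γ z) := by
  have hk := hν.integrable_levyKernel
  have h1 : ∫ x, levyKernel (z + w) x ∂ν + ∫ x, levyKernel (z - w) x ∂ν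
      - 2 * ∫ x, levyKernel z x ∂ν = ∫ x, -2 * ((1 - Real.cos (inner ℝ w x) : ℝ)
        * Complex.exp (((inner ℝ x z : ℝ) : ℂ) * Complex.I)) ∂ν := by
    rw [← integral_const_mul, ← integral_add (hk _) (hk _), ← integral_sub]
    rotate_left
    · exact (hk _).add (hk _)
    · exact (hk _).const_mul 2
    exact integral_congr_ae (ae_of_all _ fun x => levyKernel_second_difference z w x)
  rw [integral_const_mul] at h1
  rw [charFun_apply, integral_withDensity_eq_integral_toReal_smul (by fun_prop)
    (ae_of_all _ fun _ => ENNReal.ofReal_lt_top)]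
  simp only [ENNReal.toReal_ofReal (sub_nonneg.2 (Real.cos_le_one _)), Complex.real_smul,
    lkExponent_zero, inner_add_right, inner_sub_right]
  push_cast at h1 ⊢
  linear_combination (1 / 2) * h1

lemma restrict_support_eq_of_withDensity_eq {α : Type*} [MeasurableSpace α] {μ ν : Measure α}
    {f : α → ℝ≥0∞} (hf : Measurable f) (hf' : ∀ x, f x ≠ ∞)
    (h : μ.withDensity f = ν.withDensity f) :
    μ.restrict (Function.support f) = ν.restrict (Function.support f) := by
  have hs : MeasurableSet (Function.support f) := measurableSet_support hf
  have key : ∀ ρ : Measure α, ((ρ.withDensity f).restrict (Function.support f)).withDensity f⁻¹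
      = ρ.restrict (Function.support f) := fun ρ => by
    rw [restrict_withDensity hs]
    exact withDensity_inv_same hf (ae_restrict_mem hs) (ae_of_all _ hf')
  rw [← key μ, ← key ν, h]

/-- The uniqueness part of the Lévy–Khintchine theorem, without Gaussian part. -/
lemma eq_of_lkExponent_eq {d : ℕ} {ν₁ ν₂ : Measure (EuclideanSpace ℝ (Fin d))}
    (h₁ : IsLevyMeasure ν₁) (h₂ : IsLevyMeasure ν₂) {γ₁ γ₂ : EuclideanSpace ℝ (Fin d)}
    (h : ∀ z, lkExponent 0 ν₁ γ₁ z = lkExponent 0 ν₂ γ₂ z) : ν₁ = ν₂ ∧ γ₁ = γ₂ := by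
  let f : EuclideanSpace ℝ (Fin d) → EuclideanSpace ℝ (Fin d) → ℝ≥0∞ := fun w x =>
    ENNReal.ofReal (1 - Real.cos (inner ℝ w x))
  have hd : ∀ w, ν₁.withDensity (f w) = ν₂.withDensity (f w) := fun w => by
    have := isFiniteMeasure_withDensity_ofReal (h₁.integrable_one_sub_cos w).2
    have := isFiniteMeasure_withDensity_ofReal (h₂.integrable_one_sub_cos w).2
    refine Measure.ext_of_charFun (funext fun z => ?_)
    rw [h₁.charFun_withDensity γ₁, h₂.charFun_withDensity γ₂, h, h, h]
  have hU : ⋃ n, Function.support (f (TopologicalSpace.denseSeq _ n)) = {0}ᶜ := by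
    ext x
    simp only [Set.mem_iUnion, Set.mem_compl_iff, Set.mem_singleton_iff, f, Function.mem_support,
      ne_eq, ENNReal.ofReal_eq_zero, not_le, sub_pos]
    constructor
    · rintro ⟨n, hn⟩ rfl
      simp at hn
    · intro hx
      -- At `w = |x|⁻² x` the inner product is 1 and `cos 1 < 1`. Openness in `w` gives the same for
      -- some member of the dense sequence, so countably many weights detect every nonzero point.
      have ho : IsOpen {w : EuclideanSpace ℝ (Fin d) | Real.cos (inner ℝ w x) < 1} :=
        isOpen_lt (by fun_prop) (by fun_prop)
      obtain ⟨n, hn⟩ := (TopologicalSpace.denseRange_denseSeq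
        (EuclideanSpace ℝ (Fin d))).exists_mem_open ho ⟨(‖x‖ ^ 2)⁻¹ • x, by
          have : ‖x‖ ≠ 0 := norm_ne_zero_iff.2 hx
          simp only [Set.mem_ofPred_eq, real_inner_smul_left, real_inner_self_eq_norm_sq]
          rw [inv_mul_cancel₀ (by positivity)]
          linarith [Real.cos_one_le]⟩
      exact ⟨n, hn⟩
  have hν : ν₁ = ν₂ := by
    rw [← h₁.restrict_compl_zero, ← h₂.restrict_compl_zero, ← hU, Measure.restrict_iUnion_congr]
    exact fun n => restrict_support_eq_of_withDensity_eq (by fun_prop)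
      (fun _ => ENNReal.ofReal_ne_top) (hd _)
  refine ⟨hν, ext_inner_right ℝ fun z => ?_⟩
  have := h z
  rw [hν, lkExponent_zero, lkExponent_zero] at this
  simpa using this

/-! ### Dilation and semistability in terms of the triplet. -/

lemma dilation_apply_singleton_zero {d : ℕ} {b : ℝ} (hb : b ≠ 0)
    (ν : Measure (EuclideanSpace ℝ (Fin d))) : dilation b ν {0} = ν {0} := by
  rw [dilation, Measure.map_apply (by fun_prop) (measurableSet_singleton _)]
  congr 1
  ext x
  simp [hb]

lemma IsLevyMeasure.dilation {d : ℕ} {ν : Measure (EuclideanSpace ℝ (Fin d))}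
    (hν : IsLevyMeasure ν) {b : ℝ} (hb : 1 < b) : IsLevyMeasure (dilation b ν) := by
  refine ⟨by rw [dilation_apply_singleton_zero (by positivity), hν.1], ?_⟩
  rw [InversionID.dilation, lintegral_map (by fun_prop) (by fun_prop)]
  refine lt_of_le_of_lt (lintegral_mono (g := fun x =>
    ENNReal.ofReal (b ^ 2) * ENNReal.ofReal (min (‖x‖ ^ 2) 1)) fun x => ?_) ?_
  · beta_reduce
    rw [← ENNReal.ofReal_mul (by positivity)]
    refine ENNReal.ofReal_le_ofReal ?_
    rw [norm_smul, mul_pow, Real.norm_eq_abs, sq_abs, mul_min_of_nonneg _ _ (by positivity)]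
    exact min_le_min le_rfl (by nlinarith)
  · rw [lintegral_const_mul _ (by fun_prop)]
    exact ENNReal.mul_lt_top ENNReal.ofReal_lt_top hν.2

lemma lkExponent_add_right {d : ℕ} (ν : Measure (EuclideanSpace ℝ (Fin d)))
    (γ c z : EuclideanSpace ℝ (Fin d)) :
    lkExponent 0 ν (γ + c) z = lkExponent 0 ν γ z + ((inner ℝ c z : ℝ) : ℂ) * Complex.I := by
  simp only [lkExponent_zero, inner_add_left]
  push_cast
  ring

/-- The half-open annulus `b⁻¹ < |x| ≤ 1`. -/
def annulus (d : ℕ) (b : ℝ) : Set (EuclideanSpace ℝ (Fin d)) :=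
  {x | b⁻¹ < ‖x‖} ∩ {x | ‖x‖ ≤ 1}

lemma measurableSet_annulus {d : ℕ} (b : ℝ) : MeasurableSet (annulus d b) :=
  (measurableSet_lt (by fun_prop) (by fun_prop)).inter
    (measurableSet_le (by fun_prop) (by fun_prop))

lemma IsLevyMeasure.integrableOn_annulus {d : ℕ} {ν : Measure (EuclideanSpace ℝ (Fin d))}
    (hν : IsLevyMeasure ν) {b : ℝ} (hb : 1 < b) : IntegrableOn (fun x => x) (annulus d b) ν :=
  hν.integrableOn_id (r := b⁻¹) (R := 1) (by positivity) (fun _ hx => hx) (measurableSet_annulus b)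

/-- The truncations `|x| ≤ 1` and `|bx| ≤ 1` differ exactly on the annulus, which yields the drift
correction under dilation. -/
lemma levyKernel_smul {d : ℕ} {b : ℝ} (hb : 1 < b) (z x : EuclideanSpace ℝ (Fin d)) :
    levyKernel (b • z) x = levyKernel z (b • x)
      - (annulus d b).indicator (fun y => ((inner ℝ (b • z) y : ℝ) : ℂ) * Complex.I) x := by
  have hb0 : 0 < b := by positivity
  have h1 : b • x ∈ Metric.closedBall (0 : EuclideanSpace ℝ (Fin d)) 1 ↔ ‖x‖ ≤ b⁻¹ := by
    rw [mem_closedBall_zero_iff, norm_smul, Real.norm_of_nonneg hb0.le, mul_comm,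
      ← le_div_iff₀ hb0, one_div]
  have hb1 : b⁻¹ < 1 := inv_lt_one_of_one_lt₀ hb
  have hin : (inner ℝ (b • z) x : ℝ) = inner ℝ z (b • x) := by
    rw [real_inner_smul_left, real_inner_smul_right]
  unfold levyKernel
  rw [hin]
  rcases le_or_gt ‖x‖ b⁻¹ with h | h
  · rw [Set.indicator_of_mem (h1.2 h), Set.indicator_of_mem (by simpa using h.trans hb1.le),
      Set.indicator_of_notMem (fun hx => absurd h hx.1.not_ge), hin]
    ring
  · rw [Set.indicator_of_notMem (fun hx => absurd (h1.1 hx) h.not_ge)]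
    by_cases h2 : ‖x‖ ≤ 1
    · rw [Set.indicator_of_mem (by simpa using h2), Set.indicator_of_mem (show x ∈ annulus d b from ⟨h, h2⟩), hin]
      ring
    · rw [Set.indicator_of_notMem (by simpa using h2),
        Set.indicator_of_notMem (fun hx => h2 hx.2)]
      ring

lemma IsLevyMeasure.lkExponent_smul_right {d : ℕ} {ν : Measure (EuclideanSpace ℝ (Fin d))}
    (hν : IsLevyMeasure ν) {b : ℝ} (hb : 1 < b) (γ z : EuclideanSpace ℝ (Fin d)) :
    lkExponent 0 ν γ (b • z)
      = lkExponent 0 (InversionID.dilation b ν) (b • (γ - ∫ x in annulus d b, x ∂ν)) z := by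
  have hA := measurableSet_annulus (d := d) b
  have hid := hν.integrableOn_annulus hb
  have h1 : Integrable (fun x => levyKernel z (b • x)) ν := by
    have := (hν.dilation hb).integrable_levyKernel z
    rwa [InversionID.dilation, integrable_map_measure
      (measurable_levyKernel z).aestronglyMeasurable (by fun_prop)] at this
  have h2 : ∫ x, levyKernel z x ∂(InversionID.dilation b ν) = ∫ x, levyKernel z (b • x) ∂ν := by
    rw [InversionID.dilation, integral_map (by fun_prop)
      (measurable_levyKernel z).aestronglyMeasurable]
  have h3 : ∫ x, levyKernel (b • z) x ∂ν = ∫ x, levyKernel z (b • x) ∂ν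
      - ((inner ℝ (∫ x in annulus d b, x ∂ν) (b • z) : ℝ) : ℂ) * Complex.I := by
    simp_rw [levyKernel_smul hb]
    rw [integral_sub h1, integral_indicator hA, integral_mul_const, integral_complex_ofReal,
      integral_inner hid, real_inner_comm]
    rw [integrable_indicator_iff hA]
    exact ((hid.const_inner (b • z)).ofReal (𝕜 := ℂ)).mul_const _
  rw [lkExponent_zero, lkExponent_zero, h2, h3]
  simp only [real_inner_smul_left, real_inner_smul_right, inner_sub_left]
  push_cast
  ring

lemma isConvPower_iff {d : ℕ} {μ ν : Measure (EuclideanSpace ℝ (Fin d))}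
    {γ : EuclideanSpace ℝ (Fin d)} (hμ : HasTriplet μ 0 ν γ) {b s : ℝ} (hb : 1 < b) (hs : 0 ≤ s)
    (c : EuclideanSpace ℝ (Fin d)) :
    IsConvPower μ s (dilation b μ ∗ Measure.dirac c) ↔
      dilation b ν = ENNReal.ofReal s • ν ∧
        b • (γ - ∫ x in annulus d b, x ∂ν) + c = s • γ := by
  obtain ⟨⟨hp, -⟩, -, hν, hcf⟩ := hμ
  have : IsProbabilityMeasure (dilation b μ) := Measure.isProbabilityMeasure_map (by fun_prop)
  have hρ : ∀ z, charFun (dilation b μ ∗ Measure.dirac c) z = Complex.exp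
      (lkExponent 0 (dilation b ν) (b • (γ - ∫ x in annulus d b, x ∂ν) + c) z) := fun z => by
    rw [charFun_conv, charFun_dirac, dilation, charFun_map_smul, hcf, ← Complex.exp_add,
      hν.lkExponent_smul_right hb, lkExponent_add_right, dilation]
  constructor
  · rintro ⟨-, ψ, hψ, hψ0, hψμ, hψρ⟩
    -- A continuous logarithm vanishing at 0 is unique, so equality of characteristic functions
    -- lifts to equality of exponents.
    have hψe : ψ = lkExponent 0 ν γ := eq_of_exp_eq (a := 0) hψ (hν.continuous_lkExponent γ)
      (fun z => by rw [← hψμ, hcf]) (by rw [hψ0, lkExponent_zero_apply_zero])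
    have he := eq_of_exp_eq (a := 0) ((hν.dilation hb).continuous_lkExponent
      (b • (γ - ∫ x in annulus d b, x ∂ν) + c))
      (g := fun z => (s : ℂ) * ψ z) (by fun_prop) (fun z => by rw [← hρ, hψρ])
      (by simp [hψ0, lkExponent_zero_apply_zero])
    refine eq_of_lkExponent_eq (hν.dilation hb) (hν.smul ENNReal.ofReal_ne_top) fun z => ?_
    rw [he, lkExponent_smul ν hs, hψe]
  · rintro ⟨h1, h2⟩
    refine ⟨inferInstance, lkExponent 0 ν γ, hν.continuous_lkExponent γ,
      lkExponent_zero_apply_zero ν γ, hcf, fun z => ?_⟩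
    rw [hρ, h1, h2, lkExponent_smul ν hs]

/-- The free shift `c` absorbs any drift mismatch, so only the Lévy measure matters. -/
lemma isSemistable_iff {d : ℕ} {μ ν : Measure (EuclideanSpace ℝ (Fin d))}
    {γ : EuclideanSpace ℝ (Fin d)} (hμ : HasTriplet μ 0 ν γ) {b : ℝ} (hb : 1 < b) (α : ℝ) :
    IsSemistable α b μ ↔ dilation b ν = ENNReal.ofReal (b ^ α) • ν := by
  have hs : 0 ≤ b ^ α := by positivity
  refine ⟨fun ⟨_, c, hc⟩ => ((isConvPower_iff hμ hb hs c).1 hc).1, fun h =>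
    ⟨hμ.1, _, (isConvPower_iff hμ hb hs (b ^ α • γ - b • (γ - ∫ x in annulus d b, x ∂ν))).2
      ⟨h, by abel⟩⟩⟩

lemma isStrictlySemistable_iff {d : ℕ} {μ ν : Measure (EuclideanSpace ℝ (Fin d))}
    {γ : EuclideanSpace ℝ (Fin d)} (hμ : HasTriplet μ 0 ν γ) {b : ℝ} (hb : 1 < b) (α : ℝ) :
    IsStrictlySemistable α b μ ↔ dilation b ν = ENNReal.ofReal (b ^ α) • ν ∧
      b • (γ - ∫ x in annulus d b, x ∂ν) = b ^ α • γ := by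
  have hs : 0 ≤ b ^ α := by positivity
  have hp := hμ.1.1
  have : IsProbabilityMeasure (dilation b μ) := Measure.isProbabilityMeasure_map (by fun_prop)
  have h := isConvPower_iff hμ hb hs 0
  rw [Measure.conv_dirac_zero, add_zero] at h
  rw [← h]
  exact and_iff_right hμ.1

/-! ### Inversion of Lévy measures and of distributions. -/

lemma measurable_geomInv {d : ℕ} : Measurable (geomInv (d := d)) := by
  unfold geomInv; fun_prop

lemma norm_geomInv {d : ℕ} (x : EuclideanSpace ℝ (Fin d)) : ‖geomInv x‖ = ‖x‖⁻¹ := by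
  rcases eq_or_ne ‖x‖ 0 with h | h
  · simp [geomInv, h]
  · rw [geomInv, norm_smul, norm_inv, norm_pow, norm_norm]
    field

lemma geomInv_geomInv {d : ℕ} (x : EuclideanSpace ℝ (Fin d)) : geomInv (geomInv x) = x := by
  rcases eq_or_ne x 0 with rfl | h
  · simp [geomInv]
  · have : ‖x‖ ≠ 0 := norm_ne_zero_iff.2 h
    rw [geomInv, norm_geomInv, geomInv, smul_smul,
      show ((‖x‖⁻¹ ^ 2)⁻¹ * (‖x‖ ^ 2)⁻¹ : ℝ) = 1 by field, one_smul]

lemma smul_geomInv_smul {d : ℕ} {b : ℝ} (hb : b ≠ 0) (x : EuclideanSpace ℝ (Fin d)) :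
    b • geomInv (b • x) = geomInv x := by
  rw [geomInv, geomInv, smul_smul, smul_smul, norm_smul, mul_pow, Real.norm_eq_abs, sq_abs,
    mul_inv]
  congr 1
  field

/-- The image `ν'(B) = ∫ 1_B(ι(x)) |x|² ν(dx)` of a measure under the inversion. -/
noncomputable def levyInversion {d : ℕ} (ν : Measure (EuclideanSpace ℝ (Fin d))) :
    Measure (EuclideanSpace ℝ (Fin d)) :=
  (ν.withDensity fun x => ENNReal.ofReal (‖x‖ ^ 2)).map geomInv

lemma lintegral_levyInversion {d : ℕ} (ν : Measure (EuclideanSpace ℝ (Fin d)))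
    {f : EuclideanSpace ℝ (Fin d) → ℝ≥0∞} (hf : Measurable f) :
    ∫⁻ x, f x ∂(levyInversion ν) = ∫⁻ x, ENNReal.ofReal (‖x‖ ^ 2) * f (geomInv x) ∂ν := by
  rw [levyInversion, lintegral_map hf measurable_geomInv,
    lintegral_withDensity_eq_lintegral_mul (g := fun x => f (geomInv x)) _ (by fun_prop)
      (hf.comp measurable_geomInv)]
  rfl

lemma levyInversion_apply {d : ℕ} (ν : Measure (EuclideanSpace ℝ (Fin d)))
    {B : Set (EuclideanSpace ℝ (Fin d))} (hB : MeasurableSet B) :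
    levyInversion ν B
      = ∫⁻ x in {0}ᶜ, B.indicator 1 (geomInv x) * ENNReal.ofReal (‖x‖ ^ 2) ∂ν := by
  rw [← lintegral_indicator_one hB, lintegral_levyInversion ν (measurable_one.indicator hB),
    ← lintegral_indicator (measurableSet_singleton _).compl]
  refine lintegral_congr fun x => ?_
  rcases eq_or_ne x 0 with rfl | h
  · simp
  · rw [Set.indicator_of_mem (show x ∈ ({0} : Set _)ᶜ from h), mul_comm]

lemma IsLevyMeasure.ae_ne_zero {d : ℕ} {ν : Measure (EuclideanSpace ℝ (Fin d))}
    (hν : IsLevyMeasure ν) : ∀ᵐ x ∂ν, x ≠ 0 := by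
  rw [ae_iff]
  simpa using hν.1

/-- The weight makes the integrability condition self-dual: `|x|² min(|x|⁻², 1) ≤ min(|x|², 1)`. -/
lemma IsLevyMeasure.levyInversion {d : ℕ} {ν : Measure (EuclideanSpace ℝ (Fin d))}
    (hν : IsLevyMeasure ν) : IsLevyMeasure (levyInversion ν) := by
  constructor
  · rw [← lintegral_indicator_one (measurableSet_singleton _),
      lintegral_levyInversion ν (measurable_one.indicator (measurableSet_singleton _)),
      lintegral_eq_zero_iff' (by
        refine Measurable.aemeasurable (Measurable.mul (by fun_prop) ?_)
        exact (measurable_one.indicator (measurableSet_singleton _)).comp measurable_geomInv)]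
    filter_upwards [hν.ae_ne_zero] with x hx
    have : geomInv x ≠ 0 := by
      rw [← norm_ne_zero_iff, norm_geomInv]; simpa using hx
    simp [this]
  · rw [lintegral_levyInversion ν (by fun_prop)]
    refine lt_of_le_of_lt (lintegral_mono fun x => ?_) hν.2
    rw [← ENNReal.ofReal_mul (by positivity), norm_geomInv]
    refine ENNReal.ofReal_le_ofReal ?_
    rw [mul_min_of_nonneg _ _ (by positivity), mul_one, ← mul_pow, min_comm]
    refine min_le_min le_rfl (pow_le_one₀ (by positivity) ?_)
    exact mul_inv_le_one

lemma IsLevyMeasure.levyInversion_levyInversion {d : ℕ}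
    {ν : Measure (EuclideanSpace ℝ (Fin d))} (hν : IsLevyMeasure ν) :
    InversionID.levyInversion (InversionID.levyInversion ν) = ν := by
  refine Measure.ext_of_lintegral _ fun f hf => ?_
  have hg := measurable_geomInv (d := d)
  rw [lintegral_levyInversion _ hf, lintegral_levyInversion _ (by fun_prop)]
  refine lintegral_congr_ae ?_
  filter_upwards [hν.ae_ne_zero] with x hx
  have : ‖x‖ ≠ 0 := norm_ne_zero_iff.2 hx
  rw [geomInv_geomInv, ← mul_assoc, ← ENNReal.ofReal_mul (by positivity), norm_geomInv, ← mul_pow,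
    mul_inv_cancel₀ this]
  simp

/-- Off the null set `{0}`, weight and inversion cancel: `|x|² ι(x) = x`. -/
lemma IsLevyMeasure.setIntegral_levyInversion {d : ℕ}
    {ν : Measure (EuclideanSpace ℝ (Fin d))} (hν : IsLevyMeasure ν)
    {B : Set (EuclideanSpace ℝ (Fin d))} (hB : MeasurableSet B) :
    ∫ x in B, x ∂(InversionID.levyInversion ν) = ∫ x in geomInv ⁻¹' B, x ∂ν := by
  have hg := measurable_geomInv (d := d)
  rw [InversionID.levyInversion, setIntegral_map hB (by fun_prop) (by fun_prop),
    restrict_withDensity (hg hB), integral_withDensity_eq_integral_toReal_smul (by fun_prop)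
      (ae_of_all _ fun _ => ENNReal.ofReal_lt_top)]
  refine integral_congr_ae (ae_restrict_of_ae ?_)
  filter_upwards [hν.ae_ne_zero] with x hx
  have : ‖x‖ ≠ 0 := norm_ne_zero_iff.2 hx
  rw [ENNReal.toReal_ofReal (by positivity), geomInv, smul_smul, mul_inv_cancel₀ (by positivity),
    one_smul]

lemma measurableSet_sphere_zero {d : ℕ} (r : ℝ) :
    MeasurableSet (Metric.sphere (0 : EuclideanSpace ℝ (Fin d)) r) :=
  Metric.isClosed_sphere.measurableSet

lemma IsLevyMeasure.setIntegral_sphere_levyInversion {d : ℕ}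
    {ν : Measure (EuclideanSpace ℝ (Fin d))} (hν : IsLevyMeasure ν) :
    ∫ x in Metric.sphere 0 1, x ∂(InversionID.levyInversion ν)
      = ∫ x in Metric.sphere 0 1, x ∂ν := by
  rw [hν.setIntegral_levyInversion (measurableSet_sphere_zero 1)]
  congr 2
  ext x
  simp [norm_geomInv]

lemma isInversion_iff {d : ℕ} {μ μ' : Measure (EuclideanSpace ℝ (Fin d))} :
    IsInversion μ μ' ↔ ∃ (ν : Measure (EuclideanSpace ℝ (Fin d)))
      (γ : EuclideanSpace ℝ (Fin d)), HasTriplet μ 0 ν γ ∧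
      HasTriplet μ' 0 (levyInversion ν) (-γ + ∫ x in Metric.sphere 0 1, x ∂ν) := by
  constructor
  · rintro ⟨ν, ν', γ, γ', h, h', hB, rfl⟩
    have : ν' = levyInversion ν :=
      Measure.ext fun B hBm => by rw [hB B hBm, levyInversion_apply ν hBm]
    subst this
    exact ⟨ν, γ, h, h'⟩
  · rintro ⟨ν, γ, h, h'⟩
    exact ⟨ν, _, γ, _, h, h', fun B hB => levyInversion_apply ν hB, rfl⟩

/-- The unit sphere is fixed by `ι`, so its first moment `S` is unchanged and `-(-γ + S) + S = γ`.
-/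
lemma IsInversion.symm {d : ℕ} {μ μ' : Measure (EuclideanSpace ℝ (Fin d))}
    (h : IsInversion μ μ') : IsInversion μ' μ := by
  rw [isInversion_iff] at h ⊢
  obtain ⟨ν, γ, h, h'⟩ := h
  have hν : IsLevyMeasure ν := h.2.2.1
  refine ⟨_, _, h', ?_⟩
  rw [hν.levyInversion_levyInversion, hν.setIntegral_sphere_levyInversion]
  simpa using h

lemma IsID0.isInversion_inversion {d : ℕ} {μ : Measure (EuclideanSpace ℝ (Fin d))}
    (hμ : IsID0 μ) : IsInversion μ (inversion μ) := by
  obtain ⟨ν, γ, h⟩ := hμ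
  obtain ⟨μ', h'⟩ := (IsLevyMeasure.levyInversion h.2.2.1).exists_hasTriplet
    (-γ + ∫ x in Metric.sphere 0 1, x ∂ν)
  exact Classical.epsilon_spec (p := IsInversion μ) ⟨μ', isInversion_iff.2 ⟨ν, γ, h, h'⟩⟩

/-! ### Transfer of the semistability equations. -/

lemma dilation_levyInversion {d : ℕ} {ν : Measure (EuclideanSpace ℝ (Fin d))} {b α : ℝ}
    (hb : 0 < b) (h : dilation b ν = ENNReal.ofReal (b ^ α) • ν) :
    dilation b (levyInversion ν) = ENNReal.ofReal (b ^ (2 - α)) • levyInversion ν := by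
  have hg := measurable_geomInv (d := d)
  refine Measure.ext_of_lintegral _ fun f hf => ?_
  rw [dilation, lintegral_map hf (by fun_prop), lintegral_levyInversion _ (by fun_prop),
    lintegral_smul_measure, lintegral_levyInversion _ hf, smul_eq_mul]
  have hs : 0 < b ^ α := by positivity
  -- Testing the scaling of `ν` on `|x|² f(b ι(x))`, with `b ι(bx) = ι(x)`, gives `b² ∫ f dν' = b^α
  -- ∫ f(bx) ν'(dx)`.
  have key := congrArg
    (fun ρ => ∫⁻ x, ENNReal.ofReal (‖x‖ ^ 2) * f (b • geomInv x) ∂ρ) h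
  beta_reduce at key
  rw [dilation, lintegral_map (by fun_prop) (by fun_prop), lintegral_smul_measure,
    smul_eq_mul] at key
  have hl : ∀ x : EuclideanSpace ℝ (Fin d),
      ENNReal.ofReal (‖b • x‖ ^ 2) * f (b • geomInv (b • x))
        = ENNReal.ofReal (b ^ 2) * (ENNReal.ofReal (‖x‖ ^ 2) * f (geomInv x)) := fun x => by
    rw [smul_geomInv_smul hb.ne', norm_smul, mul_pow, Real.norm_eq_abs, sq_abs,
      ENNReal.ofReal_mul (by positivity), mul_assoc]
  simp_rw [hl] at key
  rw [lintegral_const_mul _ (by fun_prop)] at key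
  have hp : ENNReal.ofReal (b ^ 2) = ENNReal.ofReal (b ^ α) * ENNReal.ofReal (b ^ (2 - α)) := by
    rw [← ENNReal.ofReal_mul hs.le, ← Real.rpow_add hb]
    norm_num
  rw [hp, mul_assoc] at key
  exact ((ENNReal.mul_right_inj (by simpa using hs) ENNReal.ofReal_ne_top).1 key).symm

lemma setIntegral_preimage_smul_of_dilation_eq {d : ℕ} {ν : Measure (EuclideanSpace ℝ (Fin d))}
    {b s : ℝ} (hs : 0 ≤ s) (h : dilation b ν = ENNReal.ofReal s • ν)
    {B : Set (EuclideanSpace ℝ (Fin d))} (hB : MeasurableSet B) :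
    b • ∫ x in (fun x => b • x) ⁻¹' B, x ∂ν = s • ∫ x in B, x ∂ν := by
  have key := congrArg (fun ρ => ∫ x in B, x ∂ρ) h
  beta_reduce at key
  rwa [dilation, setIntegral_map hB (by fun_prop) (by fun_prop), Measure.restrict_smul,
    integral_smul_measure, ENNReal.toReal_ofReal hs, integral_smul] at key

/-- The drift of the inverted triplet satisfies the strict semistability relation. -/
lemma drift_levyInversion {d : ℕ} {ν : Measure (EuclideanSpace ℝ (Fin d))}
    (hν : IsLevyMeasure ν) {b α : ℝ} (hb : 1 < b) (γ : EuclideanSpace ℝ (Fin d))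
    (h : dilation b ν = ENNReal.ofReal (b ^ α) • ν)
    (hγ : b • (γ - ∫ x in annulus d b, x ∂ν) = b ^ α • γ) :
    b • ((-γ + ∫ x in Metric.sphere 0 1, x ∂ν) - ∫ x in annulus d b, x ∂(levyInversion ν))
      = b ^ (2 - α) • (-γ + ∫ x in Metric.sphere 0 1, x ∂ν) := by
  have hb0 : 0 < b := by positivity
  have hs : 0 < b ^ α := by positivity
  set U : Set (EuclideanSpace ℝ (Fin d)) := {x | 1 < ‖x‖} ∩ {x | ‖x‖ < b} with hU
  have hUm : MeasurableSet U := (measurableSet_lt (by fun_prop) (by fun_prop)).inter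
    (measurableSet_lt (by fun_prop) (by fun_prop))
  have hS : ∀ r, MeasurableSet (Metric.sphere (0 : EuclideanSpace ℝ (Fin d)) r) :=
    measurableSet_sphere_zero
  have iU : IntegrableOn (fun x => x) U ν :=
    hν.integrableOn_id one_pos (fun x hx => ⟨hx.1, hx.2.le⟩) hUm
  have iS : ∀ r, 0 < r → IntegrableOn (fun x => x) (Metric.sphere 0 r) ν := fun r hr =>
    hν.integrableOn_id (r := r / 2) (R := r) (by positivity) (fun x hx => by
      rw [mem_sphere_zero_iff_norm] at hx
      rw [hx]
      exact ⟨by linarith, le_rfl⟩) (hS r)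
  -- Inversion exchanges the open and closed ends: `b⁻¹ < |x| ≤ 1` becomes `1 ≤ |x| < b`, whereas
  -- dilation of the annulus gives `1 < |x| ≤ b`. Hence both spheres are split off.
  have e1 : geomInv ⁻¹' annulus d b = Metric.sphere 0 1 ∪ U := by
    ext x
    rcases eq_or_ne x 0 with rfl | hx
    · simp [annulus, hU, geomInv, hb0.not_gt, not_lt_of_gt (zero_lt_one' ℝ)]
    · have : 0 < ‖x‖ := norm_pos_iff.2 hx
      simp only [annulus, hU, Set.mem_preimage, Set.mem_inter_iff, Set.mem_ofPred_eq, norm_geomInv,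
        Set.mem_union, mem_sphere_zero_iff_norm, inv_lt_inv₀ hb0 this, inv_le_one₀ this]
      grind
  have e2 : (fun x : EuclideanSpace ℝ (Fin d) => b • x) ⁻¹' (U ∪ Metric.sphere 0 b)
      = annulus d b := by
    ext x
    have h1 : b⁻¹ < ‖x‖ ↔ 1 < b * ‖x‖ := by rw [inv_lt_iff_one_lt_mul₀' hb0]
    simp only [annulus, hU, Set.mem_preimage, Set.mem_inter_iff, Set.mem_ofPred_eq, norm_smul,
      Set.mem_union, mem_sphere_zero_iff_norm, Real.norm_of_nonneg hb0.le, h1]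
    have h2 : ‖x‖ ≤ 1 ↔ b * ‖x‖ ≤ b := by
      rw [mul_le_iff_le_one_right hb0]
    rw [h2]
    grind
  have e3 : (fun x : EuclideanSpace ℝ (Fin d) => b • x) ⁻¹' (Metric.sphere 0 b)
      = Metric.sphere 0 1 := by
    ext x
    simp [norm_smul, abs_of_pos hb0, hb0.ne']
  have d1 : Disjoint (Metric.sphere 0 1) U := Set.disjoint_left.2 fun x hx hxU => by
    rw [mem_sphere_zero_iff_norm] at hx
    exact absurd hxU.1 (by simp [hx])
  have d2 : Disjoint U (Metric.sphere 0 b) := Set.disjoint_left.2 fun x hxU hx => by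
    rw [mem_sphere_zero_iff_norm] at hx
    exact absurd hxU.2 (by simp [hx])
  have k1 := setIntegral_preimage_smul_of_dilation_eq hs.le h (hUm.union (hS b))
  have k2 := setIntegral_preimage_smul_of_dilation_eq hs.le h (hS b)
  rw [e2, setIntegral_union d2 (hS b) iU (iS b hb0)] at k1
  rw [e3] at k2
  rw [hν.setIntegral_levyInversion (measurableSet_annulus b), e1,
    setIntegral_union d1 hUm (iS 1 one_pos) iU]
  have hp : b ^ (2 - α) = b ^ 2 / b ^ α := by
    rw [Real.rpow_sub hb0]; norm_num
  rw [hp]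
  generalize (∫ x in annulus d b, x ∂ν) = I at *
  generalize (∫ x in Metric.sphere 0 1, x ∂ν) = S at *
  generalize (∫ x in Metric.sphere 0 b, x ∂ν) = R at *
  generalize (∫ x in U, x ∂ν) = J at *
  generalize b ^ α = s at *
  -- After multiplication by `s = b^α` the right side is `b² (-γ + S)`. Subtracting `k2` from `k1`
  -- eliminates `R`, the sphere of radius `b`, and the strictness equation eliminates `I`; this
  -- expresses `J` through `γ` and `S`.
  refine smul_right_injective _ hs.ne' ?_
  simp only [smul_smul, mul_div_cancel₀ _ hs.ne']
  have k3 : s • J = b • I - b • S := by rw [k1, k2, smul_add]; abel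
  have k4 : b • I = b • γ - s • γ := by rw [← hγ, smul_sub]; abel
  have k5 : (s * b) • J = b • (b • γ - s • γ - b • S) := by
    rw [mul_comm, mul_smul, k3, k4]
  have : (s * b) • (-γ + S - (S + J)) = -((s * b) • γ) - (s * b) • J := by module
  rw [this, k5]
  module

lemma IsInversion.isSemistable {d : ℕ} {μ μ' : Measure (EuclideanSpace ℝ (Fin d))}
    (h : IsInversion μ μ') {b α : ℝ} (hb : 1 < b) (hμ : IsSemistable α b μ) :
    IsSemistable (2 - α) b μ' := by
  obtain ⟨ν, γ, h1, h2⟩ := isInversion_iff.1 h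
  rw [isSemistable_iff h1 hb] at hμ
  rw [isSemistable_iff h2 hb]
  exact dilation_levyInversion (by positivity) hμ

lemma IsInversion.isStrictlySemistable {d : ℕ} {μ μ' : Measure (EuclideanSpace ℝ (Fin d))}
    (h : IsInversion μ μ') {b α : ℝ} (hb : 1 < b) (hμ : IsStrictlySemistable α b μ) :
    IsStrictlySemistable (2 - α) b μ' := by
  obtain ⟨ν, γ, h1, h2⟩ := isInversion_iff.1 h
  rw [isStrictlySemistable_iff h1 hb] at hμ
  rw [isStrictlySemistable_iff h2 hb]
  exact ⟨dilation_levyInversion (by positivity) hμ.1,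
    drift_levyInversion h1.2.2.1 hb γ hμ.1 hμ.2⟩

lemma IsInversion.isSemistable_iff {d : ℕ} {μ μ' : Measure (EuclideanSpace ℝ (Fin d))}
    (h : IsInversion μ μ') {b : ℝ} (hb : 1 < b) (α : ℝ) :
    IsSemistable (2 - α) b μ' ↔ IsSemistable α b μ :=
  ⟨fun h' => by simpa using h.symm.isSemistable hb h', h.isSemistable hb⟩

lemma IsInversion.isStrictlySemistable_iff {d : ℕ} {μ μ' : Measure (EuclideanSpace ℝ (Fin d))}
    (h : IsInversion μ μ') {b : ℝ} (hb : 1 < b) (α : ℝ) :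
    IsStrictlySemistable (2 - α) b μ' ↔ IsStrictlySemistable α b μ :=
  ⟨fun h' => by simpa using h.symm.isStrictlySemistable hb h', h.isStrictlySemistable hb⟩

end InversionID

theorem theorem2p1 {d : ℕ} (α b : ℝ) (hα0 : 0 < α) (hα2 : α < 2) (hb : 1 < b)
    (μ : MeasureTheory.Measure (EuclideanSpace ℝ (Fin d))) (hμ : InversionID.IsID0 μ) :
    (InversionID.IsSemistable (2 - α) b (InversionID.inversion μ) ↔
      InversionID.IsSemistable α b μ) ∧
    (InversionID.IsStrictlySemistable (2 - α) b (InversionID.inversion μ) ↔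
      InversionID.IsStrictlySemistable α b μ) ∧
    (InversionID.IsStable (2 - α) (InversionID.inversion μ) ↔ InversionID.IsStable α μ) ∧
    (InversionID.IsStrictlyStable (2 - α) (InversionID.inversion μ) ↔
      InversionID.IsStrictlyStable α μ) := by
  have h := hμ.isInversion_inversion
  exact ⟨h.isSemistable_iff hb α, h.isStrictlySemistable_iff hb α,
    forall₂_congr fun b hb => h.isSemistable_iff hb α,
    forall₂_congr fun b hb => h.isStrictlySemistable_iff hb α⟩
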